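/- Rings and algebras are associative and need not have an identity element. Let $K$ be a field of characteristic $0$ and let $R$ be a $K$-algebra with a $K$-linear derivation $d\colon R\to R$ that is surjective and locally nilpotent (for each $r\in R$ there is $n\ge 1$ with $d^n(r)=0$). Put $R^d=\ker d$ and $T=\ker d^2$. Assume that $R$ is generated as a $K$-algebra by $T$ and that $R^d$ is commutative. Then the Jacobson radical $J(R)$ of $R$ is locally nilpotent, i.e. every finitely generated subring of $J(R)$ is nilpotent. Moreover, $$J(R)^2\subseteq P(R^d)\langle T\rangle^*,$$ where $P(R^d)$ is the prime radical (the intersection of all prime ideals) of the ring $R^d$, and $P(R^d)\langle T\rangle^*$ is the set of all finite sums of elements $p\,t_1t_2\cdots t_n$ with $n\ge 0$, $p\in P(R^d)$ and $t_1,\dots,t_n\in T$. -/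

import Mathlib

/-! Rings are associative and need not have an identity element. -/

section

variable {R : Type*} [NonUnitalRing R]

/-- The Jacobson radical of a ring: its largest quasi-regular two-sided ideal, given as the sum
of all the two-sided ideals that consist of quasi-regular elements. -/
def jacobsonRadical (R : Type*) [NonUnitalRing R] : TwoSidedIdeal R :=
  sSup {I : TwoSidedIdeal R | ∀ x ∈ I, IsQuasiregular x}

/-- A two-sided ideal `Q` is prime if it is proper and `A B ⊆ Q` implies `A ⊆ Q` or `B ⊆ Q`
for two-sided ideals `A`, `B`. -/
def IsPrimeTwoSided (Q : TwoSidedIdeal R) : Prop :=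
  Q ≠ ⊤ ∧ ∀ A B : TwoSidedIdeal R, (∀ a ∈ A, ∀ b ∈ B, a * b ∈ Q) → A ≤ Q ∨ B ≤ Q

/-- The prime radical of a ring: the intersection of its prime ideals. -/
def primeRadical (R : Type*) [NonUnitalRing R] : TwoSidedIdeal R :=
  sInf {Q : TwoSidedIdeal R | IsPrimeTwoSided Q}

/-- The product `r t₁ t₂ ⋯ tₙ` for `l = [t₁, …, tₙ]`; it is `r` if `l` is empty. -/
def mulWord (r : R) (l : List R) : R := l.foldl (· * ·) r

/-- A subring `S` is nilpotent: for some `n`, all products of `n + 1` elements of `S` vanish. -/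
def IsNilpotentSubring (S : NonUnitalSubring R) : Prop :=
  ∃ n : ℕ, ∀ s ∈ S, ∀ l : List R, (∀ t ∈ l, t ∈ S) → l.length = n → mulWord s l = 0

/-- An ideal is locally nilpotent if all of its finitely generated subrings are nilpotent. -/
def IsLocallyNilpotent (I : TwoSidedIdeal R) : Prop :=
  ∀ F : Finset R, (∀ x ∈ F, x ∈ I) → IsNilpotentSubring (NonUnitalSubring.closure (F : Set R))

/-- `P⟨T⟩*`: the finite sums of elements `r ω` with `r ∈ P` and `ω` a (possibly empty) word in
elements of `T`, as an additive subgroup of `R`. -/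
def skewStar (P T : Set R) : AddSubgroup R :=
  AddSubgroup.closure {x | ∃ r ∈ P, ∃ l : List R, (∀ t ∈ l, t ∈ T) ∧ x = mulWord r l}

/-- The subalgebra `R^d = ker d` of constants of a derivation `d`. -/
def constants {K : Type*} [Field K] [Module K R] (d : R →ₗ[K] R)
    (hd : ∀ x y, d (x * y) = d x * y + x * d y) : NonUnitalSubalgebra K R where
  carrier := {r | d r = 0}
  add_mem' {a b} ha hb := by
    simp only [Set.mem_ofPred_eq] at *
    rw [map_add, ha, hb, add_zero]
  zero_mem' := map_zero d
  mul_mem' {a b} ha hb := by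
    simp only [Set.mem_ofPred_eq] at *
    rw [hd, ha, hb, zero_mul, mul_zero, add_zero]
  smul_mem' c x hx := by
    simp only [Set.mem_ofPred_eq] at *
    rw [map_smul, hx, smul_zero]

end

/-!
Write `A` for the ring of constants, `T = ker d²`, `N` for the prime radical of `A`, and
`I = N⟨T⟩*`, which is an ideal of `R`.

* `I` is locally nilpotent, hence contained in the Jacobson radical `J`. The elements of `T` act on
  `A` as derivations, and `N` consists of nilpotent elements. Filter `A`, and with it `R`, by giving
  weight `c + 1 - i` to the `i`-th derivatives of finitely many elements `p ∈ N` with respect to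
  finitely many derivations. In weight, multiplication by `p` gains `c + 1` and multiplication by
  `t ∈ T` loses at most `1`, so a word `p t₁ ⋯ tₗ` with `l ≤ c` gains at least `1`. As `A` is
  torsion-free, derivatives of nilpotent elements are nilpotent, so the filtration is finite.
* If `r ∈ J` and `dⁿ⁺¹ r = 0`, then the leading coefficient `dⁿ r` lies in `N`: comparing top degree
  terms in `r + y + y r = 0` shows that it is nilpotent.
* `R J ⊆ I`. For `r ∈ J` of degree `n`, a constant `a` and `u` with `dⁿ u = a`, the element
  `a r - (dⁿ r) u` of `J` has degree less than `n` and `(dⁿ r) u ∈ I`. As `R = A⟨T⟩*` and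
  commutators with `T` preserve `J` and the degree, induction on `n` gives `R (R r) ⊆ I`,
  and `R = R R`.
-/

section Derivations

variable {k C : Type*} [CommSemiring k] [CommRing C] [Algebra k C]

theorem isNilpotent_derivation_apply [IsAddTorsionFree C] (δ : Derivation k C C) {x : C}
    (hx : IsNilpotent x) : IsNilpotent (δ x) := by
  obtain ⟨n, hn⟩ := hx
  suffices ∀ m j, x ^ m * δ x ^ (j + 1) = 0 → IsNilpotent (δ x) from
    this n 0 (by rw [hn, zero_mul])
  intro m
  induction m with
  | zero => exact fun j h => ⟨j + 1, by rwa [pow_zero, one_mul] at h⟩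
  | succ m ih =>
    intro j h
    have leibniz : δ (x ^ (m + 1) * δ x ^ (j + 1)) * δ x = (m + 1) • (x ^ m * δ x ^ (j + 2 + 1)) +
        (j + 1) • (x ^ (m + 1) * δ x ^ (j + 1)) * δ (δ x) := by
      simp only [Derivation.leibniz, Derivation.leibniz_pow, add_tsub_cancel_right, smul_eq_mul,
        nsmul_eq_mul]
      ring
    rw [h, map_zero, zero_mul, smul_zero, zero_mul, add_zero] at leibniz
    exact ih (j + 2) (nsmul_right_injective m.succ_ne_zero (by simpa using leibniz.symm))

/-- The elements of `Q` and their iterated derivatives of order at most `i` under the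
derivations in `E`. -/
def derivSet (E : Set (Derivation k C C)) (Q : Set C) : ℕ → Set C
  | 0 => Q
  | i + 1 => derivSet E Q i ∪ ⋃ δ ∈ E, δ '' derivSet E Q i

variable {E : Set (Derivation k C C)} {Q : Set C}

theorem derivSet_monotone : Monotone (derivSet E Q) :=
  monotone_nat_of_le_succ fun _ => Set.subset_union_left

theorem derivSet_finite (hE : E.Finite) (hQ : Q.Finite) (i : ℕ) : (derivSet E Q i).Finite := by
  induction i with
  | zero => exact hQ
  | succ i ih => exact ih.union (hE.biUnion fun δ _ => ih.image δ)

theorem isNilpotent_of_mem_derivSet [IsAddTorsionFree C] (hQ : ∀ q ∈ Q, IsNilpotent q) {i : ℕ}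
    {x : C} (hx : x ∈ derivSet E Q i) : IsNilpotent x := by
  induction i generalizing x with
  | zero => exact hQ x hx
  | succ i ih =>
    rcases hx with hx | hx
    · exact ih hx
    · obtain ⟨δ, -, y, hy, rfl⟩ := Set.mem_iUnion₂.1 hx
      exact isNilpotent_derivation_apply δ (ih hy)

variable (E Q) in
/-- The ideal generated by the derivatives of order at most `i` of the elements of `Q`. -/
def derivIdeal (i : ℕ) : Ideal C := Ideal.span (derivSet E Q i)

theorem derivIdeal_monotone : Monotone (derivIdeal E Q) := fun _ _ h =>
  Ideal.span_mono (derivSet_monotone h)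

theorem derivation_apply_mem_derivIdeal {δ : Derivation k C C} (hδ : δ ∈ E) {i : ℕ} {x : C}
    (hx : x ∈ derivIdeal E Q i) : δ x ∈ derivIdeal E Q (i + 1) := by
  induction hx using Submodule.span_induction with
  | mem x hx => exact Ideal.subset_span (.inr (Set.mem_biUnion hδ ⟨x, hx, rfl⟩))
  | zero => rw [map_zero]; exact zero_mem _
  | add x y _ _ hx hy => rw [map_add]; exact add_mem hx hy
  | smul c x hxmem hx =>
    rw [smul_eq_mul, Derivation.leibniz]
    exact add_mem (Ideal.mul_mem_left _ c hx)
      (Ideal.mul_mem_right _ _ (derivIdeal_monotone i.le_succ hxmem))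

theorem isNilpotent_derivIdeal [IsAddTorsionFree C] (hE : E.Finite) (hQ : Q.Finite)
    (hnil : ∀ q ∈ Q, IsNilpotent q) (i : ℕ) : IsNilpotent (derivIdeal E Q i) :=
  (Ideal.FG.isNilpotent_iff_le_nilradical (Submodule.fg_span (derivSet_finite hE hQ i))).2
    (Ideal.span_le.2 fun _ hx => isNilpotent_of_mem_derivSet hnil hx)

/-- The filtration in which the elements of `𝔮 i` have weight `c + 1 - i` for `i ≤ c`. -/
def weightedFiltration (𝔮 : ℕ → Ideal C) (c : ℕ) : ℕ → Ideal C
  | 0 => ⊤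
  | w + 1 => ⨆ i : Fin (c + 1), 𝔮 i * weightedFiltration 𝔮 c (w + i - c)
decreasing_by omega

variable {𝔮 : ℕ → Ideal C} {c : ℕ}

theorem weightedFiltration_zero : weightedFiltration 𝔮 c 0 = ⊤ := by
  rw [weightedFiltration]

theorem mul_mem_weightedFiltration {i w : ℕ} (hi : i ≤ c) {q x : C} (hq : q ∈ 𝔮 i)
    (hx : x ∈ weightedFiltration 𝔮 c w) : q * x ∈ weightedFiltration 𝔮 c (w + c + 1 - i) := by
  rw [show w + c + 1 - i = w + (c - i) + 1 by omega, weightedFiltration]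
  refine Ideal.mem_iSup_of_mem (⟨i, by omega⟩ : Fin (c + 1)) (Ideal.mul_mem_mul hq ?_)
  rwa [show w + (c - i) + i - c = w by omega]

theorem weightedFiltration_antitone : Antitone (weightedFiltration 𝔮 c) := by
  refine antitone_nat_of_succ_le fun w => ?_
  induction w using Nat.strong_induction_on with
  | _ w ih =>
  rcases w with _ | w
  · rw [weightedFiltration_zero]; exact le_top
  rw [weightedFiltration, weightedFiltration]
  refine iSup_mono fun i => Ideal.mul_mono_right ?_
  obtain h | h : w + 1 + i - c = w + i - c ∨ w + 1 + i - c = (w + i - c) + 1 := by omega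
  · rw [h]
  · rw [h]; exact ih _ (by omega)

theorem derivation_apply_mem_weightedFiltration {δ : Derivation k C C}
    (hδ : ∀ i, ∀ q ∈ 𝔮 i, δ q ∈ 𝔮 (i + 1)) {w : ℕ} {x : C}
    (hx : x ∈ weightedFiltration 𝔮 c w) : δ x ∈ weightedFiltration 𝔮 c (w - 1) := by
  induction w using Nat.strong_induction_on generalizing x with
  | _ w ih =>
  rcases w with _ | w
  · rw [weightedFiltration_zero]; exact Submodule.mem_top
  rw [weightedFiltration] at hx
  induction hx using Submodule.iSup_induction' with
  | zero => rw [map_zero]; exact zero_mem _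
  | add x y _ _ hx hy => rw [map_add]; exact add_mem hx hy
  | mem i x hx =>
  induction hx using Submodule.mul_induction_on' with
  | add x _ y _ hx hy => rw [map_add]; exact add_mem hx hy
  | mem_mul_mem q hq y hy =>
  have hi : (i : ℕ) ≤ c := Nat.lt_succ_iff.1 i.2
  rw [Derivation.leibniz, smul_eq_mul, smul_eq_mul, mul_comm y]
  refine add_mem ?_ ?_
  · exact weightedFiltration_antitone (by omega)
      (mul_mem_weightedFiltration hi hq (ih _ (by omega) hy))
  · rcases hi.eq_or_lt with hic | hic
    · exact Ideal.mul_mem_left _ _ (weightedFiltration_antitone (by omega) hy)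
    · exact weightedFiltration_antitone (by omega)
        (mul_mem_weightedFiltration hic (hδ i q hq) hy)

theorem weightedFiltration_le_pow (h𝔮 : Monotone 𝔮) (n : ℕ) :
    weightedFiltration 𝔮 c (n * (c + 1)) ≤ 𝔮 c ^ n := by
  induction n with
  | zero => rw [pow_zero, Ideal.one_eq_top]; exact le_top
  | succ n ih =>
    rw [show (n + 1) * (c + 1) = n * (c + 1) + c + 1 by ring, weightedFiltration, pow_succ']
    exact iSup_le fun i => Ideal.mul_mono (h𝔮 (Nat.lt_succ_iff.1 i.2))
      ((weightedFiltration_antitone (by omega)).trans ih)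

end Derivations

section Nilpotence

open scoped Pointwise

variable {R : Type*} [NonUnitalRing R]

theorem mulWord_cons (r t : R) (l : List R) : mulWord r (t :: l) = mulWord (r * t) l := rfl

theorem mulWord_concat (r t : R) (l : List R) : mulWord r (l ++ [t]) = mulWord r l * t := by
  simp only [mulWord, List.foldl_append, List.foldl_cons, List.foldl_nil]

theorem mul_mulWord (x r : R) (l : List R) : x * mulWord r l = mulWord (x * r) l := by
  induction l generalizing r with
  | nil => rfl
  | cons t l ih => rw [mulWord_cons, ih, mulWord_cons, mul_assoc]

variable {F : Set R} {U : ℕ → AddSubgroup R} {n : ℕ}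

theorem isNilpotentSubring_closure_of_mul_mem_succ (hanti : Antitone U) (h0 : U 0 = ⊤)
    (hn : U n = ⊥) (hF : ∀ x ∈ F, ∀ k, ∀ y ∈ U k, x * y ∈ U (k + 1)) :
    IsNilpotentSubring (NonUnitalSubring.closure F) := by
  have hraise : ∀ x ∈ NonUnitalSubring.closure F, ∀ k, ∀ y ∈ U k, x * y ∈ U (k + 1) := by
    intro x hx
    induction hx using NonUnitalSubring.closure_induction with
    | mem x hx => exact hF x hx
    | zero => intro k y _; rw [zero_mul]; exact zero_mem _
    | add a b _ _ ha hb => intro k y hy; rw [add_mul]; exact add_mem (ha k y hy) (hb k y hy)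
    | neg a _ ha => intro k y hy; rw [neg_mul]; exact neg_mem (ha k y hy)
    | mul a b _ _ ha hb =>
      intro k y hy; rw [mul_assoc]; exact hanti (k + 1).le_succ (ha _ _ (hb k y hy))
  have hword : ∀ l : List R, (∀ t ∈ l, t ∈ NonUnitalSubring.closure F) →
      ∀ s ∈ NonUnitalSubring.closure F, mulWord s l ∈ U l.length := by
    intro l
    induction l with
    | nil => intro _ s _; rw [List.length_nil, h0]; exact AddSubgroup.mem_top _
    | cons t l ih =>
      intro hl s hs
      rw [mulWord_cons, ← mul_mulWord]
      rw [List.forall_mem_cons] at hl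
      exact hraise s hs _ _ (ih hl.2 t hl.1)
  refine ⟨n, fun s hs l hl hlen => ?_⟩
  rw [← AddSubgroup.mem_bot, ← hn, ← hlen]
  exact hword l hl s hs

theorem isNilpotentSubring_closure_of_mul_mul_mem_succ (hanti : Antitone U) (h0 : U 0 = ⊤)
    (hn : U n = ⊥) (hF : ∀ x ∈ F, ∀ y ∈ F, ∀ k, ∀ z ∈ U k, x * (y * z) ∈ U (k + 1)) :
    IsNilpotentSubring (NonUnitalSubring.closure F) := by
  -- `V` refines `U` so that each single factor from `F` raises the index.
  let V : ℕ → AddSubgroup R := fun m =>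
    U ((m + 1) / 2) ⊔ AddSubgroup.closure (F * (U (m / 2) : Set R))
  refine isNilpotentSubring_closure_of_mul_mem_succ (U := V) (n := 2 * n) ?_ ?_ ?_ ?_
  · intro i j hij
    exact sup_le_sup (hanti (by omega))
      (AddSubgroup.closure_mono (Set.mul_subset_mul_left (hanti (by omega : i / 2 ≤ j / 2))))
  · exact top_le_iff.1 (h0 ▸ le_sup_left)
  · refine le_bot_iff.1 (sup_le (hn ▸ hanti (by omega)) ((AddSubgroup.closure_le _).2 ?_))
    rintro _ ⟨x, -, y, hy, rfl⟩
    rw [show 2 * n / 2 = n by omega, hn] at hy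
    obtain rfl : y = 0 := hy
    exact mul_zero x
  · intro x hx m y hy
    suffices V m ≤ (V (m + 1)).comap (AddMonoidHom.mulLeft x) from this hy
    refine sup_le (fun u hu => ?_) ((AddSubgroup.closure_le _).2 ?_)
    · exact AddSubgroup.mem_sup_right (AddSubgroup.subset_closure (Set.mul_mem_mul hx hu))
    · rintro _ ⟨a, ha, u, hu, rfl⟩
      refine AddSubgroup.mem_sup_left ?_
      rw [show (m + 1 + 1) / 2 = m / 2 + 1 by omega]
      exact hF x hx a ha _ u hu

end Nilpotence

section ModuleFiltration

variable {k C R : Type*} [CommSemiring k] [CommRing C] [Algebra k C] [NonUnitalRing R] [Module C R]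
  {E : Finset (Derivation k C C)} {Q : Finset (nilradical C)} {c : ℕ}

variable (R E Q c) in
/-- The filtration `U w • R` of a `C`-module `R`, where `U` is the weighted filtration of `C`
given by the derivatives of the elements of `Q` under `E`. -/
def moduleFiltration (w : ℕ) : AddSubgroup R :=
  (weightedFiltration (derivIdeal (E : Set (Derivation k C C))
    (Subtype.val '' (Q : Set (nilradical C)))) c w • (⊤ : Submodule C R)).toAddSubgroup

theorem moduleFiltration_antitone : Antitone (moduleFiltration R E Q c) := fun _ _ h =>
  Submodule.smul_mono_left (weightedFiltration_antitone h)

theorem moduleFiltration_zero : moduleFiltration R E Q c 0 = ⊤ := by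
  rw [moduleFiltration, weightedFiltration_zero, Submodule.top_smul, Submodule.top_toAddSubgroup]

theorem exists_moduleFiltration_eq_bot [IsAddTorsionFree C] :
    ∃ n, moduleFiltration R E Q c n = ⊥ := by
  obtain ⟨n, hn⟩ := isNilpotent_derivIdeal E.finite_toSet (Q.finite_toSet.image Subtype.val)
    (by rintro _ ⟨q, -, rfl⟩; exact q.2) c
  refine ⟨n * (c + 1), ?_⟩
  have hbot := le_bot_iff.1 ((weightedFiltration_le_pow derivIdeal_monotone n).trans hn.le)
  rw [moduleFiltration, hbot, Submodule.bot_smul, Submodule.bot_toAddSubgroup]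

theorem smul_mem_moduleFiltration {q : nilradical C} (hq : q ∈ Q) {w : ℕ} {y : R}
    (hy : y ∈ moduleFiltration R E Q c w) : (q : C) • y ∈ moduleFiltration R E Q c (w + c + 1) := by
  induction hy using Submodule.smul_induction_on' with
  | smul a ha x hx =>
    rw [smul_smul]
    exact Submodule.smul_mem_smul
      (mul_mem_weightedFiltration c.zero_le (Ideal.subset_span ⟨q, hq, rfl⟩) ha) hx
  | add x _ y _ hx hy => rw [smul_add]; exact add_mem hx hy

theorem mul_mem_moduleFiltration_pred {δ : Derivation k C C} (hδ : δ ∈ E) {t : R}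
    (ht : ∀ (a : C) (x : R), t * a • x = a • (t * x) + δ a • x) {w : ℕ} {y : R}
    (hy : y ∈ moduleFiltration R E Q c w) : t * y ∈ moduleFiltration R E Q c (w - 1) := by
  induction hy using Submodule.smul_induction_on' with
  | smul a ha x _ =>
    rw [ht]
    refine add_mem (Submodule.smul_mem_smul ?_ Submodule.mem_top)
      (Submodule.smul_mem_smul ?_ Submodule.mem_top)
    · exact weightedFiltration_antitone (Nat.sub_le w 1) ha
    · exact derivation_apply_mem_weightedFiltration
        (fun _ _ hq => derivation_apply_mem_derivIdeal hδ hq) ha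
  | add x _ y _ hx hy => rw [mul_add]; exact add_mem hx hy

theorem mulWord_mul_mem_moduleFiltration {q : nilradical C} (hq : q ∈ Q) {p : R}
    (hp : ∀ x : R, p * x = (q : C) • x) {l : List R}
    (hl : ∀ t ∈ l, ∃ δ ∈ E, ∀ (a : C) (x : R), t * a • x = a • (t * x) + δ a • x) {w : ℕ} {y : R}
    (hy : y ∈ moduleFiltration R E Q c w) :
    mulWord p l * y ∈ moduleFiltration R E Q c (w + c + 1 - l.length) := by
  induction l using List.reverseRecOn generalizing w y with
  | nil => exact (hp y).symm ▸ smul_mem_moduleFiltration hq hy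
  | append_singleton l t ih =>
    obtain ⟨δ, hδ, ht⟩ := hl t (List.mem_append_right l (List.mem_singleton_self t))
    rw [mulWord_concat, mul_assoc, List.length_append, List.length_singleton]
    exact moduleFiltration_antitone (by omega)
      (ih (fun s hs => hl s (List.mem_append_left [t] hs)) (mul_mem_moduleFiltration_pred hδ ht hy))

variable {N T : Set R}

theorem eventually_mul_mem_moduleFiltration_succ
    (hN : ∀ p ∈ N, ∃ q : C, IsNilpotent q ∧ ∀ x : R, p * x = q • x)
    (hT : ∀ t ∈ T, ∃ δ : Derivation k C C, ∀ (a : C) (x : R), t * a • x = a • (t * x) + δ a • x)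
    {s : R} (hs : s ∈ skewStar N T) :
    ∀ᶠ D : Finset (Derivation k C C) × Finset (nilradical C) × ℕ in Filter.atTop, ∀ w,
      ∀ y ∈ moduleFiltration R D.1 D.2.1 D.2.2 w,
        s * y ∈ moduleFiltration R D.1 D.2.1 D.2.2 (w + 1) := by
  classical
  choose! δ hδ using hT
  induction hs using AddSubgroup.closure_induction with
  | zero => exact .of_forall fun _ w y _ => by rw [zero_mul]; exact zero_mem _
  | add a b _ _ ha hb =>
    filter_upwards [ha, hb] with D ha hb w y hy
    rw [add_mul]; exact add_mem (ha w y hy) (hb w y hy)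
  | neg a _ ha =>
    filter_upwards [ha] with D ha w y hy
    rw [neg_mul]; exact neg_mem (ha w y hy)
  | mem s hs =>
    obtain ⟨p, hp, l, hl, rfl⟩ := hs
    obtain ⟨q, hq, hpq⟩ := hN p hp
    filter_upwards [Filter.eventually_ge_atTop ((l.map δ).toFinset, {⟨q, hq⟩}, l.length)]
      with D ⟨hD₁, hD₂, hD₃⟩ w y hy
    refine moduleFiltration_antitone (by dsimp only at hD₃; omega)
      (mulWord_mul_mem_moduleFiltration (hD₂ (Finset.mem_singleton_self _)) hpq
        (fun t ht => ⟨δ t, hD₁ (List.mem_toFinset.2 (List.mem_map_of_mem ht)), hδ t (hl t ht)⟩) hy)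

theorem isNilpotentSubring_closure_of_mul_mem_skewStar [IsAddTorsionFree C]
    (hN : ∀ p ∈ N, ∃ q : C, IsNilpotent q ∧ ∀ x : R, p * x = q • x)
    (hT : ∀ t ∈ T, ∃ δ : Derivation k C C, ∀ (a : C) (x : R), t * a • x = a • (t * x) + δ a • x)
    {F : Set R} (hF : F.Finite) (hmul : ∀ x ∈ F, ∀ y ∈ F, x * y ∈ skewStar N T) :
    IsNilpotentSubring (NonUnitalSubring.closure F) := by
  classical
  obtain ⟨D, hD⟩ := ((Filter.eventually_all_finite hF).2 fun x hx =>
    (Filter.eventually_all_finite hF).2 fun y hy =>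
      eventually_mul_mem_moduleFiltration_succ hN hT (hmul x hx y hy)).exists
  obtain ⟨n, hn⟩ := exists_moduleFiltration_eq_bot (R := R) (E := D.1) (Q := D.2.1) (c := D.2.2)
  refine isNilpotentSubring_closure_of_mul_mul_mem_succ moduleFiltration_antitone
    moduleFiltration_zero hn fun x hx y hy k z hz => ?_
  rw [← mul_assoc]
  exact hD x hx y hy k z hz

end ModuleFiltration

section SkewStar

variable {R : Type*} [NonUnitalRing R] {P T : Set R}

theorem mulWord_add (r s : R) (l : List R) : mulWord (r + s) l = mulWord r l + mulWord s l := by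
  induction l generalizing r s with
  | nil => rfl
  | cons t l ih => simp only [mulWord_cons, add_mul, ih]

theorem mulWord_mem_skewStar {r : R} (hr : r ∈ P) {l : List R} (hl : ∀ t ∈ l, t ∈ T) :
    mulWord r l ∈ skewStar P T :=
  AddSubgroup.subset_closure ⟨r, hr, l, hl, rfl⟩

theorem subset_skewStar : P ⊆ skewStar P T := fun _ hr =>
  mulWord_mem_skewStar hr (List.forall_mem_nil _)

theorem mul_mem_of_mem_skewStar {X : Set R} {Y : AddSubgroup R}
    (hX : ∀ t ∈ T, ∀ x ∈ X, t * x - x * t ∈ X) (hY : ∀ y ∈ Y, ∀ t ∈ T, y * t ∈ Y)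
    (hPX : ∀ p ∈ P, ∀ x ∈ X, p * x ∈ Y) {s : R} (hs : s ∈ skewStar P T) {x : R} (hx : x ∈ X) :
    s * x ∈ Y := by
  induction hs using AddSubgroup.closure_induction with
  | zero => rw [zero_mul]; exact zero_mem Y
  | add a b _ _ ha hb => rw [add_mul]; exact add_mem ha hb
  | neg a _ ha => rw [neg_mul]; exact neg_mem ha
  | mem s hs =>
    obtain ⟨p, hp, l, hl, rfl⟩ := hs
    induction l using List.reverseRecOn generalizing x with
    | nil => exact hPX p hp x hx
    | append_singleton l t ih =>
      rw [List.forall_mem_append, List.forall_mem_singleton] at hl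
      obtain ⟨hl, ht⟩ := hl
      have hcomm : mulWord p l * t * x = mulWord p l * x * t + mulWord p l * (t * x - x * t) := by
        noncomm_ring
      rw [mulWord_concat, hcomm]
      exact add_mem (hY _ (ih hx hl) t ht) (ih (hX t ht x hx) hl)

theorem mul_mem_skewStar_of_mem {x t : R} (hx : x ∈ skewStar P T) (ht : t ∈ T) :
    x * t ∈ skewStar P T := by
  induction hx using AddSubgroup.closure_induction with
  | mem x hx =>
    obtain ⟨r, hr, l, hl, rfl⟩ := hx
    rw [← mulWord_concat]
    exact mulWord_mem_skewStar hr
      (List.forall_mem_append.2 ⟨hl, (List.forall_mem_singleton).2 ht⟩)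
  | zero => rw [zero_mul]; exact zero_mem _
  | add a b _ _ ha hb => rw [add_mul]; exact add_mem ha hb
  | neg a _ ha => rw [neg_mul]; exact neg_mem ha

theorem mul_mem_skewStar_of_commutator_mem (hP : ∀ t ∈ T, ∀ p ∈ P, t * p - p * t ∈ P) {t x : R}
    (ht : t ∈ T) (hx : x ∈ skewStar P T) : t * x ∈ skewStar P T := by
  induction hx using AddSubgroup.closure_induction with
  | mem x hx =>
    obtain ⟨p, hp, l, hl, rfl⟩ := hx
    rw [mul_mulWord, ← add_sub_cancel (p * t) (t * p), mulWord_add, ← mulWord_cons]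
    exact add_mem (mulWord_mem_skewStar hp (List.forall_mem_cons.2 ⟨ht, hl⟩))
      (mulWord_mem_skewStar (hP t ht p hp) hl)
  | zero => rw [mul_zero]; exact zero_mem _
  | add a b _ _ ha hb => rw [mul_add]; exact add_mem ha hb
  | neg a _ ha => rw [mul_neg]; exact neg_mem ha

theorem skewStar_mul_mem (hT : NonUnitalSubring.closure T = ⊤) {x : R} (hx : x ∈ skewStar P T)
    (y : R) : x * y ∈ skewStar P T := by
  have hy : y ∈ NonUnitalSubring.closure T := hT ▸ NonUnitalSubring.mem_top y
  induction hy using NonUnitalSubring.closure_induction generalizing x with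
  | mem t ht => exact mul_mem_skewStar_of_mem hx ht
  | zero => rw [mul_zero]; exact zero_mem _
  | add y z _ _ hy hz => rw [mul_add]; exact add_mem (hy hx) (hz hx)
  | neg y _ hy => rw [mul_neg]; exact neg_mem (hy hx)
  | mul y z _ _ hy hz => rw [← mul_assoc]; exact hz (hy hx)

theorem mul_skewStar_mem (hT : NonUnitalSubring.closure T = ⊤)
    (hP : ∀ t ∈ T, ∀ p ∈ P, t * p - p * t ∈ P) (y : R) {x : R} (hx : x ∈ skewStar P T) :
    y * x ∈ skewStar P T := by
  have hy : y ∈ NonUnitalSubring.closure T := hT ▸ NonUnitalSubring.mem_top y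
  induction hy using NonUnitalSubring.closure_induction generalizing x with
  | mem t ht => exact mul_mem_skewStar_of_commutator_mem hP ht hx
  | zero => rw [zero_mul]; exact zero_mem _
  | add y z _ _ hy hz => rw [add_mul]; exact add_mem (hy hx) (hz hx)
  | neg y _ hy => rw [neg_mul]; exact neg_mem (hy hx)
  | mul y z _ _ hy hz => rw [mul_assoc]; exact hy (hz hx)

/-- `P⟨T⟩*` as a two-sided ideal, when `T` generates `R` and `P` is stable under the inner
derivations given by the elements of `T`. -/
def skewStarIdeal (hT : NonUnitalSubring.closure T = ⊤)
    (hP : ∀ t ∈ T, ∀ p ∈ P, t * p - p * t ∈ P) : TwoSidedIdeal R :=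
  .mk' (skewStar P T) (zero_mem _) add_mem neg_mem (mul_skewStar_mem hT hP _)
    (skewStar_mul_mem hT · _)

theorem mem_skewStarIdeal (hT : NonUnitalSubring.closure T = ⊤)
    (hP : ∀ t ∈ T, ∀ p ∈ P, t * p - p * t ∈ P) {x : R} :
    x ∈ skewStarIdeal hT hP ↔ x ∈ skewStar P T :=
  TwoSidedIdeal.mem_mk' ..

theorem closure_eq_top_of_adjoin_eq_top {K : Type*} [CommSemiring K] [Module K R]
    [IsScalarTower K R R] [SMulCommClass K R R] {V : Submodule K R}
    (hV : NonUnitalAlgebra.adjoin K (V : Set R) = ⊤) :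
    NonUnitalSubring.closure (V : Set R) = ⊤ := by
  rw [NonUnitalSubring.eq_top_iff']
  intro x
  have hx : x ∈ NonUnitalAlgebra.adjoin K (V : Set R) := hV ▸ NonUnitalAlgebra.mem_top
  induction hx using NonUnitalAlgebra.adjoin_induction with
  | mem x hx => exact NonUnitalSubring.subset_closure hx
  | zero => exact zero_mem _
  | add x y _ _ hx hy => exact add_mem hx hy
  | mul x y _ _ hx hy => exact mul_mem hx hy
  | smul k x hadj hx =>
    clear hadj
    induction hx using NonUnitalSubring.closure_induction with
    | mem x hx => exact NonUnitalSubring.subset_closure (V.smul_mem k hx)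
    | zero => rw [smul_zero]; exact zero_mem _
    | add x y _ _ hx hy => rw [smul_add]; exact add_mem hx hy
    | neg x _ hx => rw [smul_neg]; exact neg_mem hx
    | mul x y _ hy hx _ => rw [← smul_mul_assoc]; exact mul_mem hx hy

end SkewStar

section JacobsonRadical

variable {R : Type*} [NonUnitalRing R]

theorem isQuasiregular_add_of_mem {J : TwoSidedIdeal R} (hJ : ∀ x ∈ J, IsQuasiregular x) {a b : R}
    (ha : IsQuasiregular a) (hb : b ∈ J) : IsQuasiregular (a + b) := by
  obtain ⟨u, rfl⟩ := ha
  have hmul : ↑u⁻¹ * PreQuasiregular.equiv (PreQuasiregular.equiv.symm ↑u + b) =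
      PreQuasiregular.equiv (b + (↑u⁻¹ : PreQuasiregular R).val * b) := by
    refine PreQuasiregular.equiv.symm.injective ?_
    simp only [PreQuasiregular.equiv_symm_apply, PreQuasiregular.val_mul,
      PreQuasiregular.equiv_apply_val]
    linear_combination (norm := noncomm_ring) PreQuasiregular.add_inv_add_mul_eq_zero u
  rw [isQuasiregular_iff', ← Units.isUnit_units_mul u⁻¹, hmul, ← isQuasiregular_iff']
  exact hJ _ (add_mem hb (J.mul_mem_left _ _ hb))

theorem isQuasiregular_of_mem_jacobsonRadical {x : R} (hx : x ∈ jacobsonRadical R) :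
    IsQuasiregular x := by
  let L : TwoSidedIdeal R := .mk' {x | ∃ I : TwoSidedIdeal R, (∀ y ∈ I, IsQuasiregular y) ∧ x ∈ I}
    ⟨⊥, fun y hy => (TwoSidedIdeal.mem_bot R).1 hy ▸ ⟨1, rfl⟩, zero_mem _⟩
    (by
      rintro x y ⟨I, hI, hx⟩ ⟨J, hJ, hy⟩
      refine ⟨I ⊔ J, fun z hz => ?_,
        add_mem (TwoSidedIdeal.mem_sup_left hx) (TwoSidedIdeal.mem_sup_right hy)⟩
      obtain ⟨a, ha, b, hb, rfl⟩ := TwoSidedIdeal.mem_sup.1 hz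
      exact isQuasiregular_add_of_mem hJ (hI a ha) hb)
    (fun ⟨I, hI, hx⟩ => ⟨I, hI, neg_mem hx⟩)
    (fun ⟨I, hI, hx⟩ => ⟨I, hI, I.mul_mem_left _ _ hx⟩)
    (fun ⟨I, hI, hx⟩ => ⟨I, hI, I.mul_mem_right _ _ hx⟩)
  have hle : jacobsonRadical R ≤ L :=
    sSup_le fun I hI y hy => (TwoSidedIdeal.mem_mk' ..).2 ⟨I, hI, hy⟩
  obtain ⟨I, hI, hxI⟩ := (TwoSidedIdeal.mem_mk' ..).1 (hle hx)
  exact hI x hxI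

theorem exists_add_add_mul_eq_zero_of_mem_jacobsonRadical {x : R} (hx : x ∈ jacobsonRadical R) :
    ∃ y, y + x + x * y = 0 ∧ x + y + y * x = 0 :=
  isQuasiregular_iff.1 (isQuasiregular_of_mem_jacobsonRadical hx)

theorem inr_mulWord_replicate (x : R) (n : ℕ) :
    ((mulWord x (List.replicate n x) : R) : Unitization ℤ R) = (x : Unitization ℤ R) ^ (n + 1) := by
  induction n with
  | zero => rw [zero_add, pow_one]; rfl
  | succ n ih => rw [List.replicate_succ', mulWord_concat, Unitization.inr_mul, ih, ← pow_succ]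

theorem isQuasiregular_of_isNilpotentSubring {S : NonUnitalSubring R} (hS : IsNilpotentSubring S)
    {x : R} (hx : x ∈ S) : IsQuasiregular x := by
  obtain ⟨n, hn⟩ := hS
  have hpow : IsNilpotent (x : Unitization ℤ R) := by
    refine ⟨n + 1, ?_⟩
    rw [← inr_mulWord_replicate, hn x hx _ (fun t ht => List.eq_of_mem_replicate ht ▸ hx)
      List.length_replicate, Unitization.inr_zero]
  exact (isQuasiregular_iff_isUnit' ℤ).2 (IsNilpotent.isUnit_one_add (R := Unitization ℤ R) hpow)

theorem le_jacobsonRadical_of_isLocallyNilpotent {I : TwoSidedIdeal R} (hI : IsLocallyNilpotent I) :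
    I ≤ jacobsonRadical R :=
  le_sSup fun x hx => isQuasiregular_of_isNilpotentSubring
    (hI {x} fun _ hy => Finset.mem_singleton.1 hy ▸ hx)
    (NonUnitalSubring.subset_closure (Finset.mem_coe.2 (Finset.mem_singleton_self x)))

end JacobsonRadical

section PrimeRadical

theorem mem_or_mem_of_isPrimeTwoSided {A : Type*} [NonUnitalCommRing A] {Q : TwoSidedIdeal A}
    (hQ : IsPrimeTwoSided Q) {a b : A} (hab : a * b ∈ Q) : a ∈ Q ∨ b ∈ Q := by
  let colon (S : Set A) : TwoSidedIdeal A := .mk' {x | ∀ s ∈ S, x * s ∈ Q}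
    (fun s _ => by rw [zero_mul]; exact zero_mem Q)
    (fun hx hy s hs => by rw [add_mul]; exact add_mem (hx s hs) (hy s hs))
    (fun hx s hs => by rw [neg_mul]; exact neg_mem (hx s hs))
    (fun hy s hs => by rw [mul_assoc]; exact Q.mul_mem_left _ _ (hy s hs))
    (fun hx s hs => by rw [mul_right_comm]; exact Q.mul_mem_right _ _ (hx s hs))
  have mem_colon {S : Set A} {x : A} : x ∈ colon S ↔ ∀ s ∈ S, x * s ∈ Q := TwoSidedIdeal.mem_mk' ..
  refine (hQ.2 (colon {b}) (colon (colon {b})) fun x hx y hy => ?_).imp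
    (fun h => h ?_) (fun h => h ?_)
  · rw [mul_comm]; exact mem_colon.1 hy x hx
  · exact mem_colon.2 fun s hs => (Set.mem_singleton_iff.1 hs) ▸ hab
  · refine mem_colon.2 fun s hs => ?_
    rw [mul_comm]; exact mem_colon.1 hs b rfl

variable {K A : Type*} [CommRing K] [NonUnitalCommRing A] [Module K A] [IsScalarTower K A A]
  [SMulCommClass K A A]

theorem mem_or_mem_of_isPrimeTwoSided_of_pow_mul_eq_zero {Q : TwoSidedIdeal A}
    (hQ : IsPrimeTwoSided Q) {a b : A} {n : ℕ}
    (hab : (a : Unitization K A) ^ n * (b : Unitization K A) = 0) : a ∈ Q ∨ b ∈ Q := by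
  induction n generalizing b with
  | zero =>
    rw [pow_zero, one_mul, ← Unitization.inr_zero K] at hab
    exact .inr (Unitization.inr_injective hab ▸ zero_mem Q)
  | succ n ih =>
    rw [pow_succ, mul_assoc, ← Unitization.inr_mul] at hab
    exact (ih hab).elim .inl (mem_or_mem_of_isPrimeTwoSided hQ)

variable (K) in
theorem mem_primeRadical_iff {a : A} : a ∈ primeRadical A ↔ IsNilpotent (a : Unitization K A) := by
  rw [primeRadical, TwoSidedIdeal.mem_sInf]
  refine ⟨fun h => nilpotent_iff_mem_prime.2 fun q hq => ?_, fun ⟨n, hn⟩ Q hQ => ?_⟩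
  · let Q : TwoSidedIdeal A := q.toTwoSided.comap (Unitization.inrNonUnitalAlgHom K A)
    have mem_Q {x : A} : x ∈ Q ↔ (x : Unitization K A) ∈ q := by
      rw [TwoSidedIdeal.mem_comap, Ideal.mem_toTwoSided]; rfl
    by_contra ha
    refine ha (mem_Q.1 (h Q ⟨?_, fun I J hIJ => ?_⟩))
    · rintro hQ; exact ha (mem_Q.1 (hQ ▸ TwoSidedIdeal.mem_top A))
    · by_contra! hne
      obtain ⟨x, hxI, hx⟩ := SetLike.not_le_iff_exists.1 hne.1
      obtain ⟨y, hyJ, hy⟩ := SetLike.not_le_iff_exists.1 hne.2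
      have hxy := mem_Q.1 (hIJ x hxI y hyJ)
      rw [Unitization.inr_mul] at hxy
      exact (hq.mem_or_mem hxy).elim (hx ∘ mem_Q.2) (hy ∘ mem_Q.2)
  · exact or_self_iff.1
      (mem_or_mem_of_isPrimeTwoSided_of_pow_mul_eq_zero hQ (by rw [hn, zero_mul]))

/-- The elements of `R` in the prime radical of the subalgebra `A`. -/
def coePrimeRadical {R : Type*} [NonUnitalRing R] [Module K R] (A : NonUnitalSubalgebra K R) :
    Set R :=
  (fun p : A => (p : R)) '' {p | p ∈ primeRadical A}

open scoped IsMulCommutative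

theorem mem_coePrimeRadical {R : Type*} [NonUnitalRing R] [Module K R] [IsScalarTower K R R]
    [SMulCommClass K R R] {A : NonUnitalSubalgebra K R} [IsMulCommutative A] {p : R} :
    p ∈ coePrimeRadical A ↔ ∃ hp : p ∈ A, IsNilpotent ((⟨p, hp⟩ : A) : Unitization K A) := by
  simp only [← mem_primeRadical_iff K, coePrimeRadical, Set.mem_image, Set.mem_ofPred_eq,
    Subtype.exists, exists_and_right, exists_eq_right]

end PrimeRadical

section CommutativeSubalgebra

open scoped IsMulCommutative

variable {K R : Type*} [CommRing K] [NonUnitalRing R] [Module K R] [IsScalarTower K R R]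
  [SMulCommClass K R R] {A : NonUnitalSubalgebra K R}

/-- `R` as a left module over the unitization of its commutative subalgebra `A`. -/
local instance unitizationModule : Module (Unitization K A) R :=
  Module.compHom R (Unitization.lift ((NonUnitalAlgHom.lmul K R).comp
    (NonUnitalSubalgebraClass.subtype A)) : Unitization K A →ₐ[K] Module.End K R).toRingHom

theorem unitization_smul_def (x : Unitization K A) (r : R) :
    x • r = x.fst • r + (x.snd : R) * r := rfl

theorem unitization_inr_smul (a : A) (r : R) : (a : Unitization K A) • r = (a : R) * r := by
  rw [unitization_smul_def, Unitization.fst_inr, Unitization.snd_inr, zero_smul, zero_add]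

variable [IsMulCommutative A]

/-- The derivation of the unitization of `A` that extends `a ↦ t * a - a * t`. -/
def commutatorDerivation {t : R} (ht : ∀ a ∈ A, t * a - a * t ∈ A) :
    Derivation K (Unitization K A) (Unitization K A) :=
  Derivation.mk' (Unitization.inrHom K K A ∘ₗ (show A →ₗ[K] A from
    (LinearMap.mulLeft K t - LinearMap.mulRight K t).restrict (p := A.toSubmodule)
      (q := A.toSubmodule) ht) ∘ₗ Unitization.sndHom K K A) fun x y => by
    have hcomm : (y.snd : R) * (t * x.snd - x.snd * t) = (t * x.snd - x.snd * t) * y.snd :=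
      setLike_mul_comm (s := A) y.snd.2 (ht _ x.snd.2)
    change (_ : Unitization K A) = x • (↑(⟨_, ht _ y.snd.2⟩ : A)) + y • (↑(⟨_, ht _ x.snd.2⟩ : A))
    refine Unitization.ext ?_ (Subtype.ext ?_)
    · simp only [smul_eq_mul, Unitization.fst_add, Unitization.fst_mul, Unitization.fst_inr,
        mul_zero, add_zero]
      rfl
    · simp only [smul_eq_mul, Unitization.snd_add, Unitization.snd_mul, Unitization.fst_inr,
        Unitization.snd_inr, zero_smul, add_zero, NonUnitalSubalgebra.coe_add,
        NonUnitalSubalgebra.coe_mul, NonUnitalSubalgebra.coe_smul, hcomm]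
      change t * ((x * y).snd : R) - ((x * y).snd : R) * t = _
      simp only [Unitization.snd_mul, NonUnitalSubalgebra.coe_add, NonUnitalSubalgebra.coe_mul,
        NonUnitalSubalgebra.coe_smul, smul_sub, mul_add, add_mul, mul_smul_comm, smul_mul_assoc]
      noncomm_ring

theorem commutatorDerivation_apply {t : R} (ht : ∀ a ∈ A, t * a - a * t ∈ A) (x : Unitization K A) :
    commutatorDerivation ht x = ((⟨_, ht _ x.snd.2⟩ : A) : Unitization K A) := rfl

theorem mul_smul_eq_add_commutatorDerivation {t : R} (ht : ∀ a ∈ A, t * a - a * t ∈ A)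
    (x : Unitization K A) (r : R) :
    t * x • r = x • (t * r) + commutatorDerivation ht x • r := by
  rw [commutatorDerivation_apply, unitization_inr_smul, unitization_smul_def, unitization_smul_def,
    mul_add, mul_smul_comm]
  noncomm_ring

variable [IsAddTorsionFree K] [IsAddTorsionFree R]

local instance unitizationIsAddTorsionFree : IsAddTorsionFree (Unitization K A) :=
  ⟨fun _ hn _ _ h => Unitization.ext (nsmul_right_injective hn (congrArg (fun x => x.fst) h))
    (Subtype.ext (nsmul_right_injective hn (congrArg (fun x => (x.snd : R)) h)))⟩

theorem commutator_mem_coePrimeRadical {t : R} (ht : ∀ a ∈ A, t * a - a * t ∈ A) {p : R}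
    (hp : p ∈ coePrimeRadical A) : t * p - p * t ∈ coePrimeRadical A := by
  rw [mem_coePrimeRadical] at hp ⊢
  obtain ⟨hpA, hp⟩ := hp
  exact ⟨ht p hpA, isNilpotent_derivation_apply (commutatorDerivation ht) hp⟩

theorem isNilpotentSubring_closure_of_mul_mem_coePrimeRadical {T : Set R}
    (hA : ∀ t ∈ T, ∀ a ∈ A, t * a - a * t ∈ A) {F : Set R} (hF : F.Finite)
    (hmul : ∀ x ∈ F, ∀ y ∈ F, x * y ∈ skewStar (coePrimeRadical A) T) :
    IsNilpotentSubring (NonUnitalSubring.closure F) := by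
  refine isNilpotentSubring_closure_of_mul_mem_skewStar (C := Unitization K A) (fun p hp => ?_)
    (fun t ht => ⟨_, mul_smul_eq_add_commutatorDerivation (hA t ht)⟩) hF hmul
  obtain ⟨hpA, hp⟩ := mem_coePrimeRadical.1 hp
  exact ⟨_, hp, fun x => (unitization_inr_smul ⟨p, hpA⟩ x).symm⟩

theorem mem_jacobsonRadical_of_mem_skewStar_coePrimeRadical {T : Set R}
    (hT : NonUnitalSubring.closure T = ⊤) (hA : ∀ t ∈ T, ∀ a ∈ A, t * a - a * t ∈ A) {x : R}
    (hx : x ∈ skewStar (coePrimeRadical A) T) : x ∈ jacobsonRadical R := by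
  let I := skewStarIdeal hT fun t ht p hp => commutator_mem_coePrimeRadical (hA t ht) hp
  have hI : IsLocallyNilpotent I := fun F hF =>
    isNilpotentSubring_closure_of_mul_mem_coePrimeRadical hA F.finite_toSet fun x hx y _ =>
      skewStar_mul_mem hT ((mem_skewStarIdeal ..).1 (hF x hx)) y
  exact le_jacobsonRadical_of_isLocallyNilpotent hI ((mem_skewStarIdeal ..).2 hx)

end CommutativeSubalgebra

section LocallyNilpotentDerivation

variable {S R : Type*} [Semiring S] [NonUnitalRing R] [Module S R] {d : R →ₗ[S] R}

theorem pow_apply_mul (hd : ∀ x y, d (x * y) = d x * y + x * d y) (n : ℕ) (x y : R) :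
    (d ^ n) (x * y) =
      ∑ ij ∈ Finset.HasAntidiagonal.antidiagonal n,
        n.choose ij.1 • ((d ^ ij.1) x * (d ^ ij.2) y) := by
  induction n with
  | zero => simp only [Finset.Nat.antidiagonal_zero, Finset.sum_singleton, pow_zero,
      Module.End.one_apply, Nat.choose_self, one_smul]
  | succ n ih =>
    rw [Finset.sum_antidiagonal_choose_succ_nsmul fun i j => (d ^ i) x * (d ^ j) y, pow_succ',
      Module.End.mul_apply, ih, map_sum, ← Finset.sum_add_distrib]
    refine Finset.sum_congr rfl fun ij hij => ?_
    have hsymm : n.choose ij.2 = n.choose ij.1 :=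
      Nat.choose_symm_of_eq_add (by rw [← Finset.HasAntidiagonal.mem_antidiagonal.1 hij, add_comm])
    rw [map_nsmul, hd, nsmul_add, add_comm, hsymm, pow_succ', pow_succ', Module.End.mul_apply,
      Module.End.mul_apply]

theorem pow_apply_constant_mul (hd : ∀ x y, d (x * y) = d x * y + x * d y) {a : R} (ha : d a = 0)
    (n : ℕ) (x : R) : (d ^ n) (a * x) = a * (d ^ n) x := by
  induction n with
  | zero => rfl
  | succ n ih =>
    rw [pow_succ', Module.End.mul_apply, ih, hd, ha, zero_mul, zero_add, Module.End.mul_apply]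

theorem pow_add_apply_mul (hd : ∀ x y, d (x * y) = d x * y + x * d y) {x y : R} {m n : ℕ}
    (hx : (d ^ (m + 1)) x = 0) (hy : (d ^ (n + 1)) y = 0) :
    (d ^ (m + n)) (x * y) = (m + n).choose m • ((d ^ m) x * (d ^ n) y) := by
  rw [pow_apply_mul hd, Finset.sum_eq_single (m, n)]
  · rintro ⟨i, j⟩ hij hne
    rw [Finset.HasAntidiagonal.mem_antidiagonal] at hij
    dsimp only at hij ⊢
    rcases lt_trichotomy i m with h | rfl | h
    · rw [Module.End.pow_map_zero_of_le (show n + 1 ≤ j by omega) hy, mul_zero, smul_zero]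
    · exact absurd (by rw [Nat.add_left_cancel hij]) hne
    · rw [Module.End.pow_map_zero_of_le h hx, zero_mul, smul_zero]
  · exact fun h => (h (Finset.HasAntidiagonal.mem_antidiagonal.2 rfl)).elim

theorem pow_apply_mul_pow_apply_eq_zero [IsAddTorsionFree R]
    (hd : ∀ x y, d (x * y) = d x * y + x * d y) {x y : R} {m n : ℕ} (hx : (d ^ (m + 1)) x = 0)
    (hy : (d ^ (n + 1)) y = 0) (hxy : (d ^ (m + n)) (x * y) = 0) : (d ^ m) x * (d ^ n) y = 0 :=
  nsmul_right_injective (Nat.choose_pos (Nat.le_add_right m n)).ne'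
    (((pow_add_apply_mul hd hx hy).symm.trans hxy).trans (smul_zero _).symm)

theorem eq_top_of_forall_mul_mem (hd : ∀ x y, d (x * y) = d x * y + x * d y)
    (hsurj : Function.Surjective d)
    (hT : NonUnitalSubring.closure (LinearMap.ker (d ^ 2) : Set R) = ⊤) {I : AddSubgroup R}
    (hI : ∀ x y, x * y ∈ I) : I = ⊤ := by
  refine I.eq_top_iff'.2 fun x => ?_
  obtain ⟨y, rfl⟩ := hsurj x
  obtain ⟨z, rfl⟩ := hsurj y
  have hz : z ∈ NonUnitalSubring.closure (LinearMap.ker (d ^ 2) : Set R) :=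
    hT ▸ NonUnitalSubring.mem_top z
  induction hz using NonUnitalSubring.closure_induction with
  | mem t ht => exact (show d (d t) = 0 from ht) ▸ zero_mem I
  | zero => rw [map_zero, map_zero]; exact zero_mem I
  | add y z _ _ hy hz => rw [map_add, map_add]; exact add_mem hy hz
  | neg y _ hy => rw [map_neg, map_neg]; exact neg_mem hy
  | mul y z =>
    rw [hd, map_add, hd, hd]
    exact add_mem (add_mem (hI _ _) (hI _ _)) (add_mem (hI _ _) (hI _ _))

end LocallyNilpotentDerivation

section DerivationKernel

open scoped IsMulCommutative

variable {K R : Type*} [CommRing K] [NonUnitalRing R] [Module K R] {d : R →ₗ[K] R}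
  {hd : ∀ x y, d (x * y) = d x * y + x * d y}

variable (d hd) in
/-- The subalgebra `ker d` of constants of a derivation `d` that is linear over a commutative ring;
over a field it is definitionally `constants d hd`. -/
def derivKer : NonUnitalSubalgebra K R where
  __ := LinearMap.ker d
  mul_mem' {a b} ha hb := show d (a * b) = 0 by
    rw [hd, show d a = 0 from ha, show d b = 0 from hb, zero_mul, mul_zero, add_zero]

theorem mem_derivKer {a : R} : a ∈ derivKer d hd ↔ d a = 0 := Iff.rfl

theorem pow_apply_mem_derivKer {n : ℕ} {r : R} (hr : (d ^ (n + 1)) r = 0) :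
    (d ^ n) r ∈ derivKer d hd := by
  rwa [pow_succ', Module.End.mul_apply] at hr

variable [IsMulCommutative (derivKer d hd)]

theorem commutator_mem_derivKer {t a : R} (ht : d (d t) = 0) (ha : a ∈ derivKer d hd) :
    t * a - a * t ∈ derivKer d hd := by
  have hcomm : d t * a = a * d t := setLike_mul_comm (s := derivKer d hd) ht ha
  rw [mem_derivKer, map_sub, hd, hd, mem_derivKer.1 ha, mul_zero, zero_mul, add_zero, zero_add,
    hcomm, sub_self]

variable (hd) in
include hd in
theorem pow_succ_apply_commutator {t r : R} (ht : d (d t) = 0) {n : ℕ}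
    (hr : (d ^ (n + 1)) r = 0) : (d ^ (n + 1)) (t * r - r * t) = 0 := by
  have ht' : (d ^ (1 + 1)) t = 0 := ht
  have hcomm : d t * (d ^ n) r = (d ^ n) r * d t :=
    setLike_mul_comm (s := derivKer d hd) ht (pow_apply_mem_derivKer hr)
  rw [map_sub, pow_add_apply_mul hd hr ht', add_comm n 1, pow_add_apply_mul hd ht' hr, pow_one,
    hcomm, ← Nat.choose_symm_add, sub_self]

theorem skewStar_derivKer_eq_top (hsurj : Function.Surjective d)
    (hT : NonUnitalSubring.closure (LinearMap.ker (d ^ 2) : Set R) = ⊤) :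
    skewStar (derivKer d hd : Set R) (LinearMap.ker (d ^ 2) : Set R) = ⊤ := by
  refine (AddSubgroup.eq_top_iff' _).2 fun x => ?_
  obtain ⟨y, rfl⟩ := hsurj x
  have hy : y ∈ NonUnitalSubring.closure (LinearMap.ker (d ^ 2) : Set R) :=
    hT ▸ NonUnitalSubring.mem_top y
  induction hy using NonUnitalSubring.closure_induction with
  | mem t ht => exact subset_skewStar ht
  | zero => rw [map_zero]; exact zero_mem _
  | add y z _ _ hy hz => rw [map_add]; exact add_mem hy hz
  | neg y _ hy => rw [map_neg]; exact neg_mem hy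
  | mul y z _ _ hy hz =>
    rw [hd]
    exact add_mem (skewStar_mul_mem hT hy z)
      (mul_skewStar_mem hT (fun _ ht _ ha => commutator_mem_derivKer ht ha) y hz)

variable [IsScalarTower K R R] [SMulCommClass K R R]

section QuasiRegular

variable [IsAddTorsionFree R]

/-- Comparing the terms of top degree shows that the leading coefficient of `z` is annihilated by
`p`, so that multiplying the equation by `p` lowers the degree of `z`. -/
theorem exists_pow_mul_eq_zero_of_add_add_mul_eq_zero {r z : R} {m n : ℕ} (hn : 1 ≤ n)
    {p q : derivKer d hd} (hr : (d ^ n) r = p) (hz : (d ^ (m + 1)) z = 0)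
    (h : q * r + z + z * r = 0) :
    ∃ j : ℕ,
      (p : Unitization K (derivKer d hd)) ^ j * (q : Unitization K (derivKer d hd)) = 0 := by
  have hr' : (d ^ (n + 1)) r = 0 := by rw [pow_succ', Module.End.mul_apply, hr]; exact p.2
  induction m generalizing q z with
  | zero =>
    have hz' : (d ^ 1) z = 0 := by rwa [zero_add] at hz
    have hqp : (q * p : R) + z * p = 0 := by
      simpa only [map_add, pow_apply_constant_mul hd q.2, pow_apply_constant_mul hd hz', hr,
        Module.End.pow_map_zero_of_le hn hz', add_zero, map_zero] using congrArg (d ^ n) h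
    have hpz : (p * z : R) = -(p * q) := by
      rw [setLike_mul_comm (s := derivKer d hd) p.2 hz', eq_neg_of_add_eq_zero_right hqp,
        setLike_mul_comm (s := derivKer d hd) q.2 p.2]
    have hpq : (p * q : R) = 0 := by
      have := congrArg ((p : R) * ·) h
      simpa only [mul_add, ← mul_assoc, hpz, mul_zero, neg_mul, add_neg_cancel_comm, neg_eq_zero]
        using this
    exact ⟨1, by rw [pow_one, ← Unitization.inr_mul, show p * q = 0 from Subtype.ext hpq,
      Unitization.inr_zero]⟩
  | succ m ih =>
    have hzr : (d ^ (m + 1 + n)) (z * r) = 0 := by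
      simpa only [map_add, pow_apply_constant_mul hd q.2, mul_zero, zero_add, map_zero,
        Module.End.pow_map_zero_of_le (show n + 1 ≤ m + 1 + n by omega) hr',
        Module.End.pow_map_zero_of_le (show m + 1 + 1 ≤ m + 1 + n by omega) hz]
        using congrArg (d ^ (m + 1 + n)) h
    have hzp : (d ^ (m + 1)) (p * z) = 0 := by
      rw [pow_apply_constant_mul hd p.2,
        setLike_mul_comm (s := derivKer d hd) p.2 (pow_apply_mem_derivKer hz), ← hr,
        pow_apply_mul_pow_apply_eq_zero hd hz hr' hzr]
    obtain ⟨j, hj⟩ := ih (q := p * q) hzp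
      (by simpa only [MulMemClass.coe_mul, mul_add, mul_assoc, mul_zero]
        using congrArg ((p : R) * ·) h)
    exact ⟨j + 1, by rw [pow_succ, mul_assoc, ← Unitization.inr_mul, hj]⟩

theorem isNilpotent_of_pow_apply_eq_of_add_add_mul_eq_zero {r y : R} {m n : ℕ}
    (hy : r + y + y * r = 0) (hm : (d ^ m) y = 0) (hn : 1 ≤ n) {p : derivKer d hd}
    (hr : (d ^ n) r = p) : IsNilpotent (p : Unitization K (derivKer d hd)) := by
  have hpy : (d ^ (m + 1)) (p * y) = 0 := by
    rw [pow_apply_constant_mul hd p.2, Module.End.pow_map_zero_of_le m.le_succ hm, mul_zero]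
  obtain ⟨j, hj⟩ := exists_pow_mul_eq_zero_of_add_add_mul_eq_zero (q := p) hn hr hpy
    (by simpa only [mul_add, mul_assoc, mul_zero] using congrArg ((p : R) * ·) hy)
  exact ⟨j + 1, by rw [pow_succ, hj]⟩

theorem pow_apply_mem_coePrimeRadical (hsurj : Function.Surjective d)
    (hnil : ∀ r, ∃ n : ℕ, (d ^ n) r = 0) {r : R} (hr : r ∈ jacobsonRadical R) {n : ℕ}
    (hn : (d ^ (n + 1)) r = 0) : (d ^ n) r ∈ coePrimeRadical (derivKer d hd) := by
  refine mem_coePrimeRadical.2 ⟨pow_apply_mem_derivKer hn, ?_⟩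
  rcases n with _ | n
  · -- A constant `d t` is replaced by `d t * t`, which has leading coefficient `(d t) ^ 2`.
    obtain ⟨t, rfl⟩ := hsurj r
    have hdt : d (d t) = 0 := hn
    obtain ⟨y, -, hy⟩ := exists_add_add_mul_eq_zero_of_mem_jacobsonRadical
      ((jacobsonRadical R).mul_mem_right _ t hr)
    obtain ⟨m, hm⟩ := hnil y
    have hlead : (d ^ 1) (d t * t) =
        ((⟨d t, hdt⟩ * ⟨d t, hdt⟩ : derivKer d hd) : R) :=
      pow_apply_constant_mul hd hdt 1 t
    have hsq := isNilpotent_of_pow_apply_eq_of_add_add_mul_eq_zero hy hm le_rfl hlead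
    rw [Unitization.inr_mul, ← sq] at hsq
    exact hsq.of_pow
  · obtain ⟨y, -, hy⟩ := exists_add_add_mul_eq_zero_of_mem_jacobsonRadical hr
    obtain ⟨m, hm⟩ := hnil y
    exact isNilpotent_of_pow_apply_eq_of_add_add_mul_eq_zero hy hm n.succ_pos rfl

end QuasiRegular

section JacobsonRadicalBound

variable [IsAddTorsionFree K] [IsAddTorsionFree R] (hsurj : Function.Surjective d)
  (hnil : ∀ r, ∃ n : ℕ, (d ^ n) r = 0)
  (hT : NonUnitalSubring.closure (LinearMap.ker (d ^ 2) : Set R) = ⊤)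
include hsurj hnil hT

theorem exists_pow_apply_constant_mul_sub_eq_zero {a : R} (ha : a ∈ derivKer d hd) {r : R}
    (hr : r ∈ jacobsonRadical R) {n : ℕ} (hn : (d ^ (n + 1)) r = 0) :
    ∃ w ∈ skewStar (coePrimeRadical (derivKer d hd)) (LinearMap.ker (d ^ 2) : Set R),
      a * r - w ∈ jacobsonRadical R ∧ (d ^ n) (a * r - w) = 0 := by
  obtain ⟨u, hu⟩ : ∃ u, (d ^ n) u = a := by
    rw [Module.End.coe_pow]; exact hsurj.iterate n a
  have hp := pow_apply_mem_coePrimeRadical (hd := hd) hsurj hnil hr hn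
  have hpd := pow_apply_mem_derivKer (hd := hd) hn
  have hpu := skewStar_mul_mem hT (subset_skewStar hp) u
  refine ⟨(d ^ n) r * u, hpu, sub_mem ((jacobsonRadical R).mul_mem_left _ _ hr)
    (mem_jacobsonRadical_of_mem_skewStar_coePrimeRadical hT
      (fun _ ht _ ha => commutator_mem_derivKer ht ha) hpu), ?_⟩
  rw [map_sub, pow_apply_constant_mul hd ha, pow_apply_constant_mul hd hpd, hu,
    setLike_mul_comm (s := derivKer d hd) ha hpd, sub_self]

theorem mul_mem_skewStar_of_mem_jacobsonRadical (x : R) {r : R} (hr : r ∈ jacobsonRadical R) :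
    x * r ∈ skewStar (coePrimeRadical (derivKer d hd)) (LinearMap.ker (d ^ 2) : Set R) := by
  set I := skewStar (coePrimeRadical (derivKer d hd)) (LinearMap.ker (d ^ 2) : Set R)
  have mul_mem_right {y : R} (hy : y ∈ I) (z : R) : y * z ∈ I := skewStar_mul_mem hT hy z
  have mul_mem_left (z : R) {y : R} (hy : y ∈ I) : z * y ∈ I := mul_skewStar_mem hT
    (fun _ ht _ => commutator_mem_coePrimeRadical fun _ => commutator_mem_derivKer ht) z hy
  obtain ⟨n, hn⟩ := hnil r
  induction n generalizing r x with
  | zero => rw [show r = 0 from hn, mul_zero]; exact zero_mem I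
  | succ n ih =>
    let Y : AddSubgroup R := ⨅ z, I.comap (AddMonoidHom.mulLeft z)
    have mem_Y {y : R} : y ∈ Y ↔ ∀ z, z * y ∈ I := AddSubgroup.mem_iInf
    suffices ∀ z, z * r ∈ Y by
      have htop := eq_top_of_forall_mul_mem (I := I.comap (AddMonoidHom.mulRight r)) hd hsurj hT
        fun y z => show y * z * r ∈ I from (mul_assoc y z r).symm ▸ mem_Y.1 (this z) y
      exact htop.ge (AddSubgroup.mem_top x)
    intro z
    have hz : z ∈ skewStar (derivKer d hd : Set R) (LinearMap.ker (d ^ 2) : Set R) :=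
      (skewStar_derivKer_eq_top hsurj hT).ge (AddSubgroup.mem_top z)
    refine mul_mem_of_mem_skewStar (X := {r | r ∈ jacobsonRadical R ∧ (d ^ (n + 1)) r = 0})
      ?_ ?_ ?_ hz ⟨hr, hn⟩
    · rintro t ht y ⟨hyJ, hy⟩
      exact ⟨sub_mem ((jacobsonRadical R).mul_mem_left _ _ hyJ)
        ((jacobsonRadical R).mul_mem_right _ _ hyJ), pow_succ_apply_commutator hd ht hy⟩
    · exact fun y hy t _ => mem_Y.2 fun z => mul_assoc z y t ▸ mul_mem_right (mem_Y.1 hy z) t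
    · rintro a ha y ⟨hyJ, hy⟩
      obtain ⟨w, hw, hwJ, hwn⟩ :=
        exists_pow_apply_constant_mul_sub_eq_zero hsurj hnil hT ha hyJ hy
      rw [← sub_add_cancel (a * y) w]
      exact add_mem (mem_Y.2 fun z => ih z hwJ hwn)
        (mem_Y.2 fun z => mul_mem_left z hw)

end JacobsonRadicalBound

end DerivationKernel

theorem theoremB_general {K R : Type*} [CommRing K] [IsAddTorsionFree K] [NonUnitalRing R]
    [IsAddTorsionFree R] [Module K R] [IsScalarTower K R R] [SMulCommClass K R R]
    (d : R →ₗ[K] R) (hd : ∀ x y, d (x * y) = d x * y + x * d y)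
    (hsurj : Function.Surjective d) (hnil : ∀ r, ∃ n : ℕ, (d ^ n) r = 0)
    (hgen : NonUnitalAlgebra.adjoin K (LinearMap.ker (d ^ 2) : Set R) = ⊤)
    (hcomm : ∀ x ∈ derivKer d hd, ∀ y ∈ derivKer d hd, x * y = y * x) :
    IsLocallyNilpotent (jacobsonRadical R) ∧
      ∀ x, ∀ r ∈ jacobsonRadical R,
        x * r ∈ skewStar (coePrimeRadical (derivKer d hd)) (LinearMap.ker (d ^ 2) : Set R) := by
  have : IsMulCommutative (derivKer d hd) :=
    .of_setLike_mul_comm fun {x} hx {y} hy => hcomm x hx y hy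
  have hT := closure_eq_top_of_adjoin_eq_top hgen
  have mul_mem (x : R) {r : R} (hr : r ∈ jacobsonRadical R) :
      x * r ∈ skewStar (coePrimeRadical (derivKer d hd)) (LinearMap.ker (d ^ 2) : Set R) :=
    mul_mem_skewStar_of_mem_jacobsonRadical hsurj hnil hT x hr
  refine ⟨fun F hF => ?_, fun x _ hr => mul_mem x hr⟩
  exact isNilpotentSubring_closure_of_mul_mem_coePrimeRadical
    (fun _ ht _ ha => commutator_mem_derivKer ht ha) F.finite_toSet
    fun x _ y hy => mul_mem x (hF y hy)

theorem theoremB {K R : Type*} [Field K] [CharZero K] [NonUnitalRing R] [Module K R]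
    [IsScalarTower K R R] [SMulCommClass K R R]
    (d : R →ₗ[K] R) (hd : ∀ x y, d (x * y) = d x * y + x * d y)
    (hsurj : Function.Surjective d)
    (hnil : ∀ r, ∃ n : ℕ, (d ^ n) r = 0)
    (hgen : NonUnitalAlgebra.adjoin K (LinearMap.ker (d ^ 2) : Set R) = ⊤)
    (hcomm : ∀ x ∈ constants d hd, ∀ y ∈ constants d hd, x * y = y * x) :
    IsLocallyNilpotent (jacobsonRadical R) ∧
      ∀ a ∈ jacobsonRadical R, ∀ b ∈ jacobsonRadical R,
        a * b ∈ skewStar ((fun p : constants d hd => (p : R)) '' {p | p ∈ primeRadical (constants d hd)})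
          (LinearMap.ker (d ^ 2) : Set R) := by
  have : IsAddTorsionFree R := .of_isTorsionFree K R
  have h := theoremB_general d hd hsurj hnil hgen hcomm
  exact ⟨h.1, fun a _ b hb => h.2 a b hb⟩
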